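/- Let $0<\mathsf q<\mathsf p$, $q=\mathsf q/\mathsf p$, and let $\alpha,\gamma\ge 0$ satisfy Liggett's condition $\frac{\alpha}{\mathsf p}+\frac{\gamma}{\mathsf q}=1$; put $\rho=\alpha/\mathsf p$. The half-line open ASEP is the Markov process $\eta(t)$ on $\{0,1\}^{\mathbb Z_{>0}}$ whose generator acts on local functions $f$ (functions of finitely many coordinates) by $$\mathscr L f(\eta)=\alpha(1-\eta_1)\big(f(\eta^+)-f(\eta)\big)+\gamma\eta_1\big(f(\eta^-)-f(\eta)\big)+\sum_{x\ge1}\big(\mathsf p\,\eta_x(1-\eta_{x+1})+\mathsf q\,\eta_{x+1}(1-\eta_x)\big)\big(f(\eta^{x,x+1})-f(\eta)\big),$$ where $\eta^{\pm}$ is $\eta$ with $\eta_1$ replaced by $1$ (for $+$) or $0$ (for $-$), and $\eta^{x,x+1}$ is $\eta$ with $\eta_x$ and $\eta_{x+1}$ exchanged. The half-line open ASEP with initial condition $\eta$ means any adapted càdlàg process with $\eta(0)=\eta$ almost surely that solves the martingale problem for $\mathscr L$: for every local $f$, $f(\eta(t))-\int_0^t\mathscr L f(\eta(s))\,ds$ is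 a martingale. Its expectation is denoted $\mathbb E^\eta$. Fix $n\ge1$, let $\mathbb W^n_{\ge1}=\{\vec x\in\mathbb Z^n: 1\le x_1<\dots<x_n\}$, $N_x(\eta)=\sum_{i\ge x}\eta_i$ and $H(\eta,\vec x)=\prod_{i=1}^n q^{N_{x_i}(\eta)}$ (with $q^\infty=0$). For $f:\mathbb W^n_{\ge1}\to\mathbb R$ define, with $x_{n+1}=+\infty$ and $\vec x_i^{\pm}$ denoting $\vec x$ with $x_i$ replaced by $x_i\pm1$, $$\mathscr D^{(n,\rho)}f(\vec x)=\sum_{\substack{2\le i\le n\\ x_i-x_{i-1}>1}}\mathsf p\big(f(\vec x_i^-)-f(\vec x)\big)+\sum_{\substack{1\le i\le n\\ x_{i+1}-x_i>1}}\mathsf q\big(f(\vec x_i^+)-f(\vec x)\big)+\mathbf 1_{x_1>1}\,\mathsf p\big(f(\vec x_1^-)-f(\vec x)\big)-\mathbf 1_{x_1=1}(\mathsf p-\mathsf q)\rho f(\vec x).$$ Let $\eta\in\{0,1\}^{\mathbb Z_{>0}}$ have finitely many particles. Then there exists a unique function $u:\mathbb R_+\times\mathbb W^n_{\ge1}\to\mathbb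 R$ such that 1. for all $\vec x\in\mathbb W^n_{\ge1}$ and $t\in\mathbb R_+=[0,\infty)$, $\frac{d}{dt}u(t,\vec x)=\mathscr D^{(n,\rho)}u(t,\vec x)$ (one-sided derivative at $t=0$); 2. for every $T>0$ there are constants $c,C>0$ such that $|u(t,\vec x)|\le C\prod_{i=1}^n e^{c|x_i|}$ for all $t\in[0,T]$ and $\vec x\in\mathbb W^n_{\ge1}$; 3. $u(0,\vec x)=H(\eta,\vec x)$ for all $\vec x\in\mathbb W^n_{\ge1}$. Moreover, for this $u$, for every half-line open ASEP $\eta(t)$ with initial condition $\eta$, and for all $t\in\mathbb R_+$ and $\vec x\in\mathbb W^n_{\ge1}$, the random variable $H(\eta(t),\vec x)$ is integrable and $u(t,\vec x)=\mathbb E^\eta[H(\eta(t),\vec x)]$. -/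

import Mathlib

open MeasureTheory ProbabilityTheory Filter Topology
open scoped NNReal

namespace HalfLineASEP

noncomputable section

/-! ### The half-line open ASEP -/

/-- Particle configurations `η ∈ {0,1}^{ℤ_{>0}}`; `η x = true` means that site `x` is occupied. -/
abbrev Config : Type := ℕ+ → Bool

/-- The occupation variable `η_x ∈ {0,1}` as a real number. -/
def occ (η : Config) (x : ℕ+) : ℝ := if η x then 1 else 0

/-- `η^{x,x+1}`: the values at the sites `x` and `x + 1` are exchanged. -/
def exchange (η : Config) (x : ℕ+) : Config := fun y => η (Equiv.swap x (x + 1) y)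

/-- A local function depends on the occupation variables of finitely many sites only. -/
def IsLocal (f : Config → ℝ) : Prop := ∃ S : Finset ℕ+, DependsOn f (S : Set ℕ+)

/-- The generator of the half-line open ASEP: particles jump right at rate `p` and left at rate `q`,
subject to exclusion; at site `1` they are created at rate `α` and annihilated at rate `γ`.
On a local function `f` only finitely many terms of the sum are nonzero. -/
def generator (p q α γ : ℝ) (f : Config → ℝ) (η : Config) : ℝ :=
  α * (1 - occ η 1) * (f (Function.update η 1 true) - f η)
    + γ * occ η 1 * (f (Function.update η 1 false) - f η)
    + ∑' x : ℕ+, (p * occ η x * (1 - occ η (x + 1)) + q * occ η (x + 1) * (1 - occ η x))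
        * (f (exchange η x) - f η)

/-- `X` is a half-line open ASEP with initial condition `η₀`, under the probability measure `μ` and
relative to the filtration `ℱ`: it is adapted, has càdlàg paths, starts at `η₀`, and solves the
martingale problem of the generator on local functions. -/
structure IsHalfLineASEP (p q α γ : ℝ) (η₀ : Config) {Ω : Type*} [mΩ : MeasurableSpace Ω]
    (μ : Measure Ω) (ℱ : Filtration ℝ≥0 mΩ) (X : ℝ≥0 → Ω → Config) : Prop where
  adapted : ∀ t, Measurable[ℱ t] (X t)
  right_continuous : ∀ ω t, ContinuousWithinAt (fun s => X s ω) (Set.Ici t) t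
  left_limits : ∀ ω t, ∃ l : Config, Tendsto (fun s => X s ω) (𝓝[<] t) (𝓝 l)
  initial : ∀ᵐ ω ∂μ, X 0 ω = η₀
  martingale : ∀ f : Config → ℝ, IsLocal f →
    Martingale (fun (t : ℝ≥0) ω =>
      f (X t ω) - ∫ s in (0 : ℝ)..(t : ℝ), generator p q α γ f (X s.toNNReal ω)) ℱ μ

/-! ### The observables -/

/-- `N_x(η) = ∑_{i ≥ x} η_i`, the number of particles at sites `i ≥ x`, possibly infinite. -/
def N (η : Config) (x : ℤ) : ℕ∞ := {i : ℕ+ | x ≤ ((i : ℕ) : ℤ) ∧ η i = true}.encard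

/-- `Q_x(η) = r ^ N_x(η)` for `r ∈ (0,1)`, with `r ^ ∞ = 0`. -/
def Q (r : ℝ) (η : Config) (x : ℤ) : ℝ := if N η x = ⊤ then 0 else r ^ (N η x).toNat

/-- The set `{x ∈ ℤ^n : 1 ≤ x_1 < ⋯ < x_n}`; the coordinates are indexed from `0` here. -/
def Weyl (n : ℕ) : Type := {x : Fin n → ℤ // StrictMono x ∧ ∀ i, 1 ≤ x i}

/-- The duality function `H(η, x) = ∏_i Q_{x_i}(η)`. -/
def H {n : ℕ} (r : ℝ) (η : Config) (x : Weyl n) : ℝ := ∏ i, Q r η (x.1 i)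

/-! ### The killed `n`-particle half-line ASEP -/

/-- The `i`-th particle can jump to the left: `x_i - x_{i-1} > 1` if `i` is not the first index,
and `x_1 > 1` if it is. -/
def CanLeft {n : ℕ} (x : Weyl n) (i : Fin n) : Prop :=
  ((i : ℕ) = 0 → 1 < x.1 i) ∧ ∀ j : Fin n, (j : ℕ) + 1 = i → 1 < x.1 i - x.1 j

/-- The `i`-th particle can jump to the right: `x_{i+1} - x_i > 1`, with `x_{n+1} = +∞`. -/
def CanRight {n : ℕ} (x : Weyl n) (i : Fin n) : Prop :=
  ∀ j : Fin n, (i : ℕ) + 1 = j → 1 < x.1 j - x.1 i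

theorem left_mem {n : ℕ} (x : Weyl n) (i : Fin n) (h : CanLeft x i) :
    StrictMono (Function.update x.1 i (x.1 i - 1)) ∧
      ∀ k, 1 ≤ Function.update x.1 i (x.1 i - 1) k := by
  obtain ⟨x, hx, h1⟩ := x
  obtain ⟨h0, hp⟩ := h
  simp only at h0 hp ⊢
  have key : ∀ a : Fin n, a < i → x a < x i - 1 := by
    intro a ha
    have ha' : (a : ℕ) < i := ha
    have hj := hp ⟨(i : ℕ) - 1, by omega⟩ (by simp only; omega)
    have : x a ≤ x ⟨(i : ℕ) - 1, by omega⟩ :=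
      hx.monotone (by rw [Fin.le_def]; simp only; omega)
    omega
  refine ⟨?_, ?_⟩
  · intro a b hab
    have hxab := hx hab
    simp only [Function.update_apply]
    split_ifs with ha hb hb
    · subst ha; subst hb; exact absurd hab (lt_irrefl _)
    · subst ha; omega
    · subst hb; exact key a hab
    · exact hxab
  · intro k
    have hk := h1 k
    simp only [Function.update_apply]
    split_ifs with hki
    · by_cases hi : (i : ℕ) = 0
      · have := h0 hi; omega
      · have := key ⟨0, by omega⟩ (by rw [Fin.lt_def]; simp only; omega)
        have := h1 ⟨0, by omega⟩
        omega
    · exact hk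

theorem right_mem {n : ℕ} (x : Weyl n) (i : Fin n) (h : CanRight x i) :
    StrictMono (Function.update x.1 i (x.1 i + 1)) ∧
      ∀ k, 1 ≤ Function.update x.1 i (x.1 i + 1) k := by
  obtain ⟨x, hx, h1⟩ := x
  unfold CanRight at h
  simp only at h ⊢
  refine ⟨?_, ?_⟩
  · intro a b hab
    have hxab := hx hab
    simp only [Function.update_apply]
    split_ifs with ha hb hb
    · subst ha; subst hb; exact absurd hab (lt_irrefl _)
    · subst ha
      have hab' : (a : ℕ) < b := hab
      have hj := h ⟨(a : ℕ) + 1, by omega⟩ rfl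
      have : x ⟨(a : ℕ) + 1, by omega⟩ ≤ x b :=
        hx.monotone (by rw [Fin.le_def]; simp only; omega)
      omega
    · subst hb; omega
    · exact hxab
  · intro k
    have hk := h1 k
    have hi := h1 i
    simp only [Function.update_apply]
    split_ifs with hki
    · omega
    · exact hk

/-- `x_i^-`: the `i`-th coordinate is decreased by one. -/
def moveLeft {n : ℕ} (x : Weyl n) (i : Fin n) (h : CanLeft x i) : Weyl n :=
  ⟨Function.update x.1 i (x.1 i - 1), left_mem x i h⟩

/-- `x_i^+`: the `i`-th coordinate is increased by one. -/
def moveRight {n : ℕ} (x : Weyl n) (i : Fin n) (h : CanRight x i) : Weyl n :=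
  ⟨Function.update x.1 i (x.1 i + 1), right_mem x i h⟩

open Classical in
/-- The operator `D^{(n,ρ)}`: each particle jumps left at rate `p` and right at rate `q` whenever it
can, and the system is killed at rate `(p - q) ρ` when the first particle is at site `1`. -/
def dualGenerator {n : ℕ} [NeZero n] (p q ρ : ℝ) (f : Weyl n → ℝ) (x : Weyl n) : ℝ :=
  (∑ i, if h : CanLeft x i then p * (f (moveLeft x i h) - f x) else 0)
    + (∑ i, if h : CanRight x i then q * (f (moveRight x i h) - f x) else 0)
    - if x.1 0 = 1 then (p - q) * ρ * f x else 0

/-- `u : ℝ_+ × Weyl n → ℝ` solves the system of equations with initial state `η`. The derivative in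
time is the one of a function on `[0, ∞)`, hence one-sided at time `0`. -/
structure IsSolution {n : ℕ} [NeZero n] (p q ρ : ℝ) (η : Config) (u : ℝ≥0 → Weyl n → ℝ) :
    Prop where
  evolution : ∀ (x : Weyl n) (t : ℝ≥0),
    HasDerivWithinAt (fun s : ℝ => u s.toNNReal x) (dualGenerator p q ρ (u t) x) (Set.Ici 0) t
  growth : ∀ T : ℝ≥0, 0 < T → ∃ c C : ℝ, 0 < c ∧ 0 < C ∧ ∀ t ≤ T, ∀ x : Weyl n,
    |u t x| ≤ C * ∏ i, Real.exp (c * |(x.1 i : ℝ)|)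
  initial : ∀ x : Weyl n, u 0 x = H (q / p) η x

end

end HalfLineASEP

namespace HalfLineASEP

noncomputable section

/-- The weight `r ^ η_x` of a single site. -/
def siteWeight (r : ℝ) (b : Bool) : ℝ := if b then r else 1

/-- The truncation of `Q r η x` to the particles at sites `≤ L`. -/
def truncQ (r : ℝ) (L : ℕ+) (η : Config) (x : ℤ) : ℝ :=
  ∏ i ∈ (Finset.Icc 1 L).filter (fun i : ℕ+ => x ≤ ((i : ℕ) : ℤ)), siteWeight r (η i)

/-- The truncation of `H r η x` to the particles at sites `≤ L`. -/
def truncH {n : ℕ} (r : ℝ) (L : ℕ+) (η : Config) (x : Weyl n) : ℝ :=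
  ∏ i, truncQ r L η (x.1 i)

section SiteWeight

variable {r : ℝ}

theorem siteWeight_nonneg (hr : 0 ≤ r) (b : Bool) : 0 ≤ siteWeight r b := by
  unfold siteWeight; split_ifs <;> positivity

theorem siteWeight_le_one (hr : r ≤ 1) (b : Bool) : siteWeight r b ≤ 1 := by
  unfold siteWeight; split_ifs <;> simp [hr]

theorem le_siteWeight (hr : r ≤ 1) (b : Bool) : r ≤ siteWeight r b := by
  unfold siteWeight; split_ifs <;> simp [hr]

theorem truncQ_nonneg (hr : 0 ≤ r) (L : ℕ+) (η : Config) (x : ℤ) : 0 ≤ truncQ r L η x :=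
  Finset.prod_nonneg fun _ _ => siteWeight_nonneg hr _

theorem truncQ_le_one (hr : 0 ≤ r) (hr1 : r ≤ 1) (L : ℕ+) (η : Config) (x : ℤ) :
    truncQ r L η x ≤ 1 :=
  Finset.prod_le_one (fun _ _ => siteWeight_nonneg hr _) fun _ _ => siteWeight_le_one hr1 _

theorem truncH_nonneg {n : ℕ} (hr : 0 ≤ r) (L : ℕ+) (η : Config) (x : Weyl n) :
    0 ≤ truncH r L η x :=
  Finset.prod_nonneg fun _ _ => truncQ_nonneg hr _ _ _

theorem truncH_le_one {n : ℕ} (hr : 0 ≤ r) (hr1 : r ≤ 1) (L : ℕ+) (η : Config) (x : Weyl n) :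
    truncH r L η x ≤ 1 :=
  Finset.prod_le_one (fun _ _ => truncQ_nonneg hr _ _ _) fun _ _ => truncQ_le_one hr hr1 _ _ _

end SiteWeight

section Recursion

variable (r : ℝ) (L : ℕ+) (η : Config)

theorem truncQ_congr {η η' : Config} {x : ℤ}
    (h : ∀ i : ℕ+, i ≤ L → x ≤ ((i : ℕ) : ℤ) → η i = η' i) :
    truncQ r L η x = truncQ r L η' x := by
  refine Finset.prod_congr rfl fun i hi => ?_
  simp only [Finset.mem_filter, Finset.mem_Icc] at hi
  rw [h i hi.1.2 hi.2]

/-- Peeling off the leftmost site. -/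
theorem truncQ_eq_mul (y : ℕ+) (hy : y ≤ L) :
    truncQ r L η ((y : ℕ) : ℤ) = siteWeight r (η y) * truncQ r L η (((y : ℕ) : ℤ) + 1) := by
  unfold truncQ
  have : (Finset.Icc 1 L).filter (fun i : ℕ+ => ((y : ℕ) : ℤ) ≤ ((i : ℕ) : ℤ))
      = insert y ((Finset.Icc 1 L).filter (fun i : ℕ+ => ((y : ℕ) : ℤ) + 1 ≤ ((i : ℕ) : ℤ))) := by
    ext i
    simp only [Finset.mem_filter, Finset.mem_Icc, Finset.mem_insert, ← PNat.coe_inj,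
      ← PNat.coe_le_coe, PNat.one_coe] at *
    have := i.pos
    have := y.pos
    omega
  rw [this, Finset.prod_insert]
  simp

theorem truncQ_update_one_of_lt (b : Bool) (x : ℤ) (hx : 1 < x) :
    truncQ r L (Function.update η 1 b) x = truncQ r L η x := by
  refine truncQ_congr r L fun i _ hi => ?_
  rw [Function.update_of_ne]
  rintro rfl
  simp at hi
  omega

theorem truncQ_update_one (b : Bool) :
    truncQ r L (Function.update η 1 b) 1 = siteWeight r b * truncQ r L η 2 := by
  have := truncQ_eq_mul r L (Function.update η 1 b) 1 one_le
  simp only [PNat.one_coe, Nat.cast_one, Function.update_self] at this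
  rw [this, truncQ_update_one_of_lt _ _ _ _ _ (by norm_num)]
  norm_num

theorem exchange_apply_of_ne {y i : ℕ+} (h1 : i ≠ y) (h2 : i ≠ y + 1) :
    exchange η y i = η i := by
  rw [exchange, Equiv.swap_apply_of_ne_of_ne h1 h2]

theorem exchange_apply_left (y : ℕ+) : exchange η y y = η (y + 1) := by
  rw [exchange, Equiv.swap_apply_left]

theorem exchange_apply_right (y : ℕ+) : exchange η y (y + 1) = η y := by
  rw [exchange, Equiv.swap_apply_right]

theorem truncQ_exchange_of_gt (y : ℕ+) (hy : L < y) (x : ℤ) :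
    truncQ r L (exchange η y) x = truncQ r L η x := by
  refine truncQ_congr r L fun i hi _ => exchange_apply_of_ne _ ?_ ?_
  · exact (hi.trans_lt hy).ne
  · exact ((hi.trans_lt hy).trans (PNat.lt_add_right _ _)).ne

theorem truncQ_exchange_of_ne (y : ℕ+) (hy : y < L) (x : ℤ) (hx : x ≠ ((y : ℕ) : ℤ) + 1) :
    truncQ r L (exchange η y) x = truncQ r L η x := by
  unfold truncQ
  refine Finset.prod_equiv (Equiv.swap y (y + 1)) (fun i => ?_) (fun i _ => rfl)
  have hy' : (y : ℕ) < L := hy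
  have hyp := y.pos
  have hip := i.pos
  rcases eq_or_ne i y with rfl | h1
  · rw [Equiv.swap_apply_left]
    have e : ((i + 1 : ℕ+) : ℕ) = i + 1 := rfl
    simp only [Finset.mem_filter, Finset.mem_Icc, ← PNat.coe_le_coe, PNat.one_coe, e]
    omega
  rcases eq_or_ne i (y + 1) with rfl | h2
  · rw [Equiv.swap_apply_right]
    have e : ((y + 1 : ℕ+) : ℕ) = y + 1 := rfl
    simp only [Finset.mem_filter, Finset.mem_Icc, ← PNat.coe_le_coe, PNat.one_coe, e]
    omega
  · rw [Equiv.swap_apply_of_ne_of_ne h1 h2]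

theorem truncQ_exchange_self (y : ℕ+) (hy : y < L) :
    truncQ r L (exchange η y) (((y : ℕ) : ℤ) + 1)
      = siteWeight r (η y) * truncQ r L η (((y : ℕ) : ℤ) + 2) := by
  have h := truncQ_eq_mul r L (exchange η y) (y + 1) (PNat.add_one_le_iff.2 hy)
  simp only [PNat.add_coe, PNat.one_coe, Nat.cast_add, Nat.cast_one] at h
  rw [h, exchange_apply_right, truncQ_exchange_of_ne _ _ _ _ hy _ (by omega)]
  ring_nf

theorem truncQ_exchange_last (x : ℤ) (hx : x ≤ ((L : ℕ) : ℤ)) :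
    siteWeight r (η L) * truncQ r L (exchange η L) x
      = siteWeight r (η (L + 1)) * truncQ r L η x := by
  have hL : L ∈ (Finset.Icc 1 L).filter (fun i : ℕ+ => x ≤ ((i : ℕ) : ℤ)) := by
    simp [hx]
  unfold truncQ
  rw [← Finset.mul_prod_erase _ _ hL, ← Finset.mul_prod_erase _ (fun i => siteWeight r (η i)) hL,
    exchange_apply_left]
  have : ∏ i ∈ ((Finset.Icc 1 L).filter (fun i : ℕ+ => x ≤ ((i : ℕ) : ℤ))).erase L,
        siteWeight r (exchange η L i)
      = ∏ i ∈ ((Finset.Icc 1 L).filter (fun i : ℕ+ => x ≤ ((i : ℕ) : ℤ))).erase L,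
        siteWeight r (η i) := by
    refine Finset.prod_congr rfl fun i hi => ?_
    simp only [Finset.mem_erase, Finset.mem_filter, Finset.mem_Icc] at hi
    rw [exchange_apply_of_ne _ hi.1]
    exact (hi.2.1.2.trans_lt (PNat.lt_add_right _ _)).ne
  rw [this]
  ring

end Recursion

section Duality

variable {n : ℕ}

/-- The value of `truncH` after moving the `i`-th coordinate to `z`, whether or not the result is
in the Weyl chamber. -/
def moveH (r : ℝ) (L : ℕ+) (η : Config) (x : Weyl n) (i : Fin n) (z : ℤ) : ℝ :=
  (∏ j ∈ Finset.univ.erase i, truncQ r L η (x.1 j)) * truncQ r L η z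

variable (r : ℝ) (L : ℕ+) (η : Config) (x : Weyl n)

theorem truncH_eq_moveH (i : Fin n) : truncH r L η x = moveH r L η x i (x.1 i) := by
  rw [moveH, Finset.prod_erase_mul _ _ (Finset.mem_univ i), truncH]

theorem prod_update_eq_moveH (i : Fin n) (z : ℤ) :
    ∏ j, truncQ r L η (Function.update x.1 i z j) = moveH r L η x i z := by
  rw [moveH, ← Finset.prod_erase_mul _ _ (Finset.mem_univ i), Function.update_self]
  congr 1
  refine Finset.prod_congr rfl fun j hj => ?_
  rw [Function.update_of_ne (Finset.ne_of_mem_erase hj)]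

theorem truncH_moveLeft (i : Fin n) (h : CanLeft x i) :
    truncH r L η (moveLeft x i h) = moveH r L η x i (x.1 i - 1) :=
  prod_update_eq_moveH r L η x i _

theorem truncH_moveRight (i : Fin n) (h : CanRight x i) :
    truncH r L η (moveRight x i h) = moveH r L η x i (x.1 i + 1) :=
  prod_update_eq_moveH r L η x i _

theorem truncH_exchange_of_gt (y : ℕ+) (hy : L < y) :
    truncH r L (exchange η y) x = truncH r L η x := by
  simp only [truncH, truncQ_exchange_of_gt r L η y hy]

theorem truncH_exchange_of_ne (y : ℕ+) (hy : y < L) (h : ∀ i, x.1 i ≠ ((y : ℕ) : ℤ) + 1) :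
    truncH r L (exchange η y) x = truncH r L η x := by
  simp only [truncH, truncQ_exchange_of_ne r L η y hy _ (h _)]

theorem truncH_exchange_of_eq (y : ℕ+) (hy : y < L) (i : Fin n)
    (h : x.1 i = ((y : ℕ) : ℤ) + 1) :
    truncH r L (exchange η y) x
      = siteWeight r (η y) * moveH r L η x i (x.1 i + 1) := by
  rw [truncH_eq_moveH r L _ x i, moveH, moveH, h, truncQ_exchange_self r L η y hy]
  have : ∏ j ∈ Finset.univ.erase i, truncQ r L (exchange η y) (x.1 j)
      = ∏ j ∈ Finset.univ.erase i, truncQ r L η (x.1 j) := by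
    refine Finset.prod_congr rfl fun j hj => truncQ_exchange_of_ne r L η y hy _ ?_
    rw [← h]
    exact fun he => Finset.ne_of_mem_erase hj (x.2.1.injective he)
  rw [this, add_assoc, one_add_one_eq_two]
  ring

/-- The rate of an exchange at the bond `(y, y + 1)`. -/
def bondRate (p q : ℝ) (η : Config) (y : ℕ+) : ℝ :=
  p * occ η y * (1 - occ η (y + 1)) + q * occ η (y + 1) * (1 - occ η y)

variable {p q : ℝ}

theorem bondRate_mul_exchange (hq : 0 < q) (hqp : q < p) (y : ℕ+) (hy : y < L) (i : Fin n)
    (h : x.1 i = ((y : ℕ) : ℤ) + 1) :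
    bondRate p q η y * (truncH (q / p) L (exchange η y) x - truncH (q / p) L η x)
      = p * (moveH (q / p) L η x i (x.1 i - 1) - truncH (q / p) L η x)
        + q * (moveH (q / p) L η x i (x.1 i + 1) - truncH (q / p) L η x) := by
  have hp : 0 < p := hq.trans hqp
  rw [truncH_exchange_of_eq _ L η x y hy i h, truncH_eq_moveH _ L η x i]
  have h1 : moveH (q / p) L η x i (x.1 i - 1)
      = siteWeight (q / p) (η y) * moveH (q / p) L η x i (x.1 i) := by
    rw [moveH, moveH, h, add_sub_cancel_right, truncQ_eq_mul _ L η y hy.le]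
    ring
  have h2 : moveH (q / p) L η x i (x.1 i)
      = siteWeight (q / p) (η (y + 1)) * moveH (q / p) L η x i (x.1 i + 1) := by
    have := truncQ_eq_mul (q / p) L η (y + 1) (PNat.add_one_le_iff.2 hy)
    simp only [PNat.add_coe, PNat.one_coe, Nat.cast_add, Nat.cast_one] at this
    rw [moveH, moveH, h, this]
    ring
  rw [h1, h2]
  unfold bondRate occ siteWeight
  cases η y <;> cases η (y + 1) <;> simp <;> field_simp <;> ring

/-- The forbidden moves of two adjacent dual particles compensate each other. -/
theorem moveH_adjacent (hq : 0 < q) (hqp : q < p) (i j : Fin n) (hij : i ≠ j)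
    (h : x.1 j = x.1 i + 1) (hL : x.1 i ≤ ((L : ℕ) : ℤ)) :
    p * (moveH (q / p) L η x j (x.1 j - 1) - truncH (q / p) L η x)
      + q * (moveH (q / p) L η x i (x.1 i + 1) - truncH (q / p) L η x) = 0 := by
  have hp : 0 < p := hq.trans hqp
  obtain ⟨y, hy⟩ : ∃ y : ℕ+, ((y : ℕ) : ℤ) = x.1 i :=
    ⟨⟨(x.1 i).toNat, by have := x.2.2 i; omega⟩, by have := x.2.2 i; simp; omega⟩
  have hyL : y ≤ L := by
    rw [← PNat.coe_le_coe]; omega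
  have hQ := truncQ_eq_mul (q / p) L η y hyL
  rw [hy] at hQ
  set R := ∏ k ∈ (Finset.univ.erase i).erase j, truncQ (q / p) L η (x.1 k) with hR
  have hi : ∏ k ∈ Finset.univ.erase i, truncQ (q / p) L η (x.1 k)
      = R * truncQ (q / p) L η (x.1 j) :=
    (Finset.prod_erase_mul _ _ (by simp [hij.symm])).symm
  have hj : ∏ k ∈ Finset.univ.erase j, truncQ (q / p) L η (x.1 k)
      = R * truncQ (q / p) L η (x.1 i) := by
    rw [hR, Finset.erase_right_comm]
    exact (Finset.prod_erase_mul _ _ (by simp [hij])).symm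
  rw [truncH_eq_moveH _ L η x i, moveH, moveH, moveH, hi, hj, h, add_sub_cancel_right, hQ]
  unfold siteWeight
  cases η y <;> simp <;> (field_simp; ring)

theorem truncH_update_of_lt [NeZero n] (b : Bool) (h : 1 < x.1 0) :
    truncH r L (Function.update η 1 b) x = truncH r L η x := by
  unfold truncH
  refine Finset.prod_congr rfl fun i _ => truncQ_update_one_of_lt _ _ _ _ _ ?_
  exact h.trans_le (x.2.1.monotone (Fin.zero_le _))

theorem truncH_update_of_eq [NeZero n] (b : Bool) (h : x.1 0 = 1) :
    truncH r L (Function.update η 1 b) x = siteWeight r b * moveH r L η x 0 2 := by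
  rw [truncH_eq_moveH r L _ x 0, moveH, moveH, h, truncQ_update_one]
  have : ∏ j ∈ Finset.univ.erase 0, truncQ r L (Function.update η 1 b) (x.1 j)
      = ∏ j ∈ Finset.univ.erase 0, truncQ r L η (x.1 j) := by
    refine Finset.prod_congr rfl fun j hj => truncQ_update_one_of_lt r L η b _ ?_
    have := x.2.1 (lt_of_le_of_ne (Fin.zero_le j) (Finset.ne_of_mem_erase hj).symm)
    omega
  rw [this]
  ring

/-- Creation and annihilation at the first site, when the first dual particle is there. -/
theorem reservoir_truncH [NeZero n] {α γ : ℝ} (hq : 0 < q) (hqp : q < p)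
    (hLiggett : α / p + γ / q = 1) (h : x.1 0 = 1) :
    α * (1 - occ η 1) * (truncH (q / p) L (Function.update η 1 true) x - truncH (q / p) L η x)
      + γ * occ η 1
        * (truncH (q / p) L (Function.update η 1 false) x - truncH (q / p) L η x)
      = q * (moveH (q / p) L η x 0 (x.1 0 + 1) - truncH (q / p) L η x)
        - (p - q) * (α / p) * truncH (q / p) L η x := by
  have hp : 0 < p := hq.trans hqp
  have hγ : γ = q * (1 - α / p) := by
    field_simp at hLiggett ⊢
    linarith
  have h2 : truncH (q / p) L η x
      = siteWeight (q / p) (η 1) * moveH (q / p) L η x 0 2 := by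
    have := truncQ_eq_mul (q / p) L η 1 one_le
    simp only [PNat.one_coe, Nat.cast_one] at this
    rw [truncH_eq_moveH _ L η x 0, moveH, moveH, h, this]
    norm_num
    ring
  rw [truncH_update_of_eq _ _ _ _ _ h, truncH_update_of_eq _ _ _ _ _ h, h2, h, hγ]
  norm_num
  unfold occ siteWeight
  cases η 1 <;> simp <;> field_simp <;> ring

/-- The contribution to the generator of the bond at the end of the truncation window. -/
def edgeTerm (p q : ℝ) (L : ℕ+) (x : Weyl n) (η : Config) : ℝ :=
  bondRate p q η L * (truncH (q / p) L (exchange η L) x - truncH (q / p) L η x)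

theorem tsum_bonds (hq : 0 < q) (hqp : q < p) (hL : ∀ i, x.1 i ≤ ((L : ℕ) : ℤ)) :
    ∑' y : ℕ+, bondRate p q η y
        * (truncH (q / p) L (exchange η y) x - truncH (q / p) L η x)
      = (∑ i, if 1 < x.1 i then
          p * (moveH (q / p) L η x i (x.1 i - 1) - truncH (q / p) L η x)
            + q * (moveH (q / p) L η x i (x.1 i + 1) - truncH (q / p) L η x) else 0)
        + edgeTerm p q L x η := by
  set g : ℕ+ → ℝ := fun y => bondRate p q η y
        * (truncH (q / p) L (exchange η y) x - truncH (q / p) L η x) with hg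
  set a : Fin n → ℝ := fun i => p * (moveH (q / p) L η x i (x.1 i - 1) - truncH (q / p) L η x)
            + q * (moveH (q / p) L η x i (x.1 i + 1) - truncH (q / p) L η x) with ha
  have hgy : ∀ y, g y = (∑ i, if x.1 i = ((y : ℕ) : ℤ) + 1 then a i else 0)
      + if y = L then g L else 0 := by
    intro y
    rcases lt_trichotomy y L with hy | rfl | hy
    · rw [if_neg hy.ne, add_zero]
      by_cases hex : ∃ i, x.1 i = ((y : ℕ) : ℤ) + 1
      · obtain ⟨i, hi⟩ := hex
        rw [Finset.sum_eq_single i, if_pos hi]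
        · exact bondRate_mul_exchange L η x hq hqp y hy i hi
        · intro j _ hj
          rw [if_neg]
          rw [← hi]
          exact fun he => hj (x.2.1.injective he)
        · simp
      · push Not at hex
        rw [Finset.sum_eq_zero fun i _ => if_neg (hex i)]
        simp only [hg]
        rw [truncH_exchange_of_ne _ _ _ _ y hy hex, sub_self, mul_zero]
    · rw [if_pos rfl, Finset.sum_eq_zero, zero_add]
      intro i _
      rw [if_neg]
      have := hL i
      omega
    · rw [if_neg hy.ne', add_zero, Finset.sum_eq_zero]
      · simp only [hg]
        rw [truncH_exchange_of_gt _ _ _ _ y hy, sub_self, mul_zero]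
      · intro i _
        rw [if_neg]
        have := hL i
        have : (L : ℕ) < y := hy
        omega
  have hsum : HasSum g ((∑ i, if 1 < x.1 i then a i else 0) + g L) := by
    refine HasSum.congr_fun ?_ hgy
    refine HasSum.add (hasSum_sum fun i _ => ?_) (hasSum_ite_eq L (g L))
    split_ifs with hi
    · obtain ⟨z, hz⟩ : ∃ z : ℕ+, ((z : ℕ) : ℤ) + 1 = x.1 i :=
        ⟨⟨(x.1 i - 1).toNat, by omega⟩, by simp; omega⟩
      have : ∀ y : ℕ+, x.1 i = ((y : ℕ) : ℤ) + 1 ↔ y = z := by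
        intro y
        rw [← hz, ← PNat.coe_inj]
        omega
      simp only [this]
      exact hasSum_ite_eq z (a i)
    · convert hasSum_zero using 2 with y
      rw [if_neg]
      have := y.pos
      omega
  exact hsum.tsum_eq

/-- The dual generator acting on the truncated duality function, with the exclusion constraint
removed. -/
theorem dualGenerator_truncH [NeZero n] (hq : 0 < q) (hqp : q < p) (ρ : ℝ)
    (hL : ∀ i, x.1 i ≤ ((L : ℕ) : ℤ)) :
    dualGenerator p q ρ (truncH (q / p) L η) x
      = (∑ i, if 1 < x.1 i then
          p * (moveH (q / p) L η x i (x.1 i - 1) - truncH (q / p) L η x)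
            + q * (moveH (q / p) L η x i (x.1 i + 1) - truncH (q / p) L η x) else 0)
        + if x.1 0 = 1 then q * (moveH (q / p) L η x 0 (x.1 0 + 1) - truncH (q / p) L η x)
            - (p - q) * ρ * truncH (q / p) L η x else 0 := by
  classical
  obtain ⟨m, rfl⟩ : ∃ m, n = m + 1 := Nat.exists_eq_succ_of_ne_zero (NeZero.ne n)
  unfold dualGenerator
  simp only [truncH_moveLeft, truncH_moveRight, dite_eq_ite]
  set h := truncH (q / p) L η x with hh
  set a : Fin (m + 1) → ℝ := fun i => p * (moveH (q / p) L η x i (x.1 i - 1) - h) with ha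
  set b : Fin (m + 1) → ℝ := fun i => q * (moveH (q / p) L η x i (x.1 i + 1) - h) with hb
  change (∑ i, if CanLeft x i then a i else 0) + (∑ i, if CanRight x i then b i else 0)
      - (if x.1 0 = 1 then (p - q) * ρ * h else 0)
    = (∑ i, if 1 < x.1 i then a i + b i else 0)
      + if x.1 0 = 1 then b 0 - (p - q) * ρ * h else 0
  have hx : ∀ j : Fin m, x.1 j.castSucc < x.1 j.succ := fun j => x.2.1 (Fin.castSucc_lt_succ)
  have hleft0 : CanLeft x 0 ↔ 1 < x.1 0 := by
    simp [CanLeft]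
  have hleft : ∀ j : Fin m, CanLeft x j.succ ↔ 1 < x.1 j.succ - x.1 j.castSucc := by
    intro j
    refine ⟨fun h => h.2 j.castSucc (by simp), fun h => ⟨by simp, fun k hk => ?_⟩⟩
    have : k = j.castSucc := by
      ext; simpa using hk
    rwa [this]
  have hright : ∀ j : Fin m, CanRight x j.castSucc ↔ 1 < x.1 j.succ - x.1 j.castSucc := by
    intro j
    refine ⟨fun h => h j.succ (by simp), fun h k hk => ?_⟩
    have : k = j.succ := by
      ext; simpa using hk.symm
    rwa [this]
  have hlast : CanRight x (Fin.last m) := by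
    intro k hk
    have := k.2
    simp at hk
    omega
  have hkey : ∀ j : Fin m, ((if CanLeft x j.succ then a j.succ else 0)
      + if CanRight x j.castSucc then b j.castSucc else 0) = a j.succ + b j.castSucc := by
    intro j
    simp only [hleft, hright]
    split_ifs with hj
    · rfl
    · rw [add_zero]
      have := hx j
      exact (moveH_adjacent L η x hq hqp j.castSucc j.succ (Fin.castSucc_lt_succ).ne
        (by omega) (hL _)).symm
  have hpos : ∀ j : Fin m, 1 < x.1 j.succ := fun j => (x.2.2 _).trans_lt (hx j)
  have hsum := Finset.sum_congr (rfl : (Finset.univ : Finset (Fin m)) = _) fun j _ => hkey j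
  simp only [Finset.sum_add_distrib] at hsum
  have hbsum : ∑ i, b i = b 0 + ∑ j : Fin m, b j.succ := Fin.sum_univ_succ b
  rw [Fin.sum_univ_castSucc] at hbsum
  rw [Fin.sum_univ_succ (fun i => if CanLeft x i then a i else 0),
    Fin.sum_univ_castSucc (fun i => if CanRight x i then b i else 0),
    Fin.sum_univ_succ (fun i => if 1 < x.1 i then a i + b i else 0), if_pos hlast]
  simp only [hpos, if_true, Finset.sum_add_distrib, hleft0]
  rcases (x.2.2 0).eq_or_lt with h1 | h1
  · rw [if_neg (by omega), if_pos h1.symm, if_neg (by omega), if_pos h1.symm]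
    linarith
  · rw [if_pos h1, if_neg (by omega), if_pos h1, if_neg (by omega)]
    linarith

/-- Duality for the truncated functions, up to the edge term. -/
theorem generator_truncH [NeZero n] {α γ : ℝ} (hq : 0 < q) (hqp : q < p)
    (hLiggett : α / p + γ / q = 1) (hL : ∀ i, x.1 i ≤ ((L : ℕ) : ℤ)) :
    generator p q α γ (fun ζ => truncH (q / p) L ζ x) η
      = dualGenerator p q (α / p) (truncH (q / p) L η) x + edgeTerm p q L x η := by
  have ht := tsum_bonds L η x hq hqp hL
  unfold bondRate at ht
  rw [generator, ht, dualGenerator_truncH L η x hq hqp _ hL]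
  split_ifs with h
  · rw [reservoir_truncH L η x hq hqp hLiggett h]
    ring
  · have h1 : 1 < x.1 0 := lt_of_le_of_ne (x.2.2 0) (Ne.symm h)
    simp only [truncH_update_of_lt _ _ _ _ _ h1]
    ring

end Duality



section Weight

variable {n : ℕ}

/-- The weight of the exponentially weighted supremum norm. -/
def expWeight (c : ℝ) (x : Weyl n) : ℝ := ∏ i, Real.exp (c * |(x.1 i : ℝ)|)

theorem expWeight_pos (c : ℝ) (x : Weyl n) : 0 < expWeight c x :=
  Finset.prod_pos fun _ _ => Real.exp_pos _

theorem one_le_expWeight {c : ℝ} (hc : 0 ≤ c) (x : Weyl n) : 1 ≤ expWeight c x :=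
  (Real.one_le_exp (Finset.sum_nonneg fun _ _ => by positivity)).trans_eq (Real.exp_sum _ _)

theorem expWeight_zero (x : Weyl n) : expWeight 0 x = 1 := by
  simp [expWeight]

theorem expWeight_mono {c d : ℝ} (hcd : c ≤ d) (x : Weyl n) : expWeight c x ≤ expWeight d x :=
  Finset.prod_le_prod (fun _ _ => (Real.exp_pos _).le) fun _ _ =>
    Real.exp_le_exp.2 (mul_le_mul_of_nonneg_right hcd (abs_nonneg _))

theorem expWeight_update_le {c : ℝ} (hc : 0 ≤ c) (x y : Weyl n) (i : Fin n) (z : ℤ)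
    (hy : y.1 = Function.update x.1 i z) (hz : |(z : ℝ)| ≤ |(x.1 i : ℝ)| + 1) :
    expWeight c y ≤ Real.exp c * expWeight c x := by
  unfold expWeight
  rw [← Finset.mul_prod_erase _ _ (Finset.mem_univ i),
    ← Finset.mul_prod_erase _ (fun j => Real.exp (c * |(x.1 j : ℝ)|)) (Finset.mem_univ i),
    ← mul_assoc, ← Real.exp_add]
  refine mul_le_mul ?_ (le_of_eq ?_) (Finset.prod_nonneg fun _ _ => (Real.exp_pos _).le)
    (Real.exp_pos _).le
  · rw [hy, Function.update_self, Real.exp_le_exp]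
    nlinarith
  · refine Finset.prod_congr rfl fun j hj => ?_
    rw [hy, Function.update_of_ne (Finset.ne_of_mem_erase hj)]

theorem expWeight_moveLeft_le {c : ℝ} (hc : 0 ≤ c) (x : Weyl n) (i : Fin n) (h : CanLeft x i) :
    expWeight c (moveLeft x i h) ≤ Real.exp c * expWeight c x := by
  refine expWeight_update_le hc x _ i (x.1 i - 1) rfl ?_
  push_cast
  simpa using abs_sub (x.1 i : ℝ) 1

theorem expWeight_moveRight_le {c : ℝ} (hc : 0 ≤ c) (x : Weyl n) (i : Fin n)
    (h : CanRight x i) :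
    expWeight c (moveRight x i h) ≤ Real.exp c * expWeight c x := by
  refine expWeight_update_le hc x _ i (x.1 i + 1) rfl ?_
  push_cast
  simpa using abs_add_le (x.1 i : ℝ) 1

/-- A bound for the norm of the dual generator on the weighted space. -/
def dualBound (n : ℕ) (p q ρ c : ℝ) : ℝ :=
  n * (|p| * (Real.exp c + 1)) + n * (|q| * (Real.exp c + 1)) + |(p - q) * ρ|

theorem dualBound_nonneg (p q ρ c : ℝ) : 0 ≤ dualBound n p q ρ c := by
  unfold dualBound; positivity

theorem Q_nonneg {r : ℝ} (hr : 0 ≤ r) (η : Config) (x : ℤ) : 0 ≤ Q r η x := by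
  unfold Q; split_ifs <;> positivity

theorem Q_le_one {r : ℝ} (hr : 0 ≤ r) (hr1 : r ≤ 1) (η : Config) (x : ℤ) : Q r η x ≤ 1 := by
  unfold Q; split_ifs
  · exact zero_le_one
  · exact pow_le_one₀ hr hr1

theorem abs_H_le_one {r : ℝ} (hr : 0 ≤ r) (hr1 : r ≤ 1) (η : Config) (x : Weyl n) :
    |H r η x| ≤ 1 := by
  rw [H, abs_of_nonneg (Finset.prod_nonneg fun _ _ => Q_nonneg hr _ _)]
  exact Finset.prod_le_one (fun _ _ => Q_nonneg hr _ _) fun _ _ => Q_le_one hr hr1 _ _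

theorem growth_of_bounded {C : ℝ} (x : Weyl n) {a : ℝ} (h : |a| ≤ C) :
    |a| ≤ (|C| + 1) * ∏ i, Real.exp (1 * |(x.1 i : ℝ)|) := by
  have h1 : 1 ≤ ∏ i, Real.exp (1 * |(x.1 i : ℝ)|) := one_le_expWeight zero_le_one x
  have h2 := le_abs_self C
  have h3 := abs_nonneg C
  nlinarith

end Weight

section DualGenerator

variable {n : ℕ} [NeZero n] (p q ρ : ℝ)

/-- The dual generator at a point is a finite linear combination of evaluations. -/
theorem exists_dualGenerator_eq_sum (x : Weyl n) :
    ∃ c : Weyl n →₀ ℝ, ∀ f : Weyl n → ℝ,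
      dualGenerator p q ρ f x = ∑ y ∈ c.support, c y * f y := by
  classical
  have key : (fun f : Weyl n → ℝ => dualGenerator p q ρ f x)
      ∈ Submodule.span ℝ (Set.range fun (y : Weyl n) (f : Weyl n → ℝ) => f y) := by
    have hev : ∀ y : Weyl n, (fun f : Weyl n → ℝ => f y)
        ∈ Submodule.span ℝ (Set.range fun (y : Weyl n) (f : Weyl n → ℝ) => f y) :=
      fun y => Submodule.subset_span ⟨y, rfl⟩
    have hL : ∀ i : Fin n, (fun f : Weyl n → ℝ =>
        if h : CanLeft x i then p * (f (moveLeft x i h) - f x) else 0)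
        ∈ Submodule.span ℝ (Set.range fun (y : Weyl n) (f : Weyl n → ℝ) => f y) := by
      intro i
      by_cases h : CanLeft x i
      · simp only [h, dite_true]
        exact Submodule.smul_mem _ p (Submodule.sub_mem _ (hev _) (hev _))
      · simp only [h, dite_false]
        exact Submodule.zero_mem _
    have hR : ∀ i : Fin n, (fun f : Weyl n → ℝ =>
        if h : CanRight x i then q * (f (moveRight x i h) - f x) else 0)
        ∈ Submodule.span ℝ (Set.range fun (y : Weyl n) (f : Weyl n → ℝ) => f y) := by
      intro i
      by_cases h : CanRight x i
      · simp only [h, dite_true]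
        exact Submodule.smul_mem _ q (Submodule.sub_mem _ (hev _) (hev _))
      · simp only [h, dite_false]
        exact Submodule.zero_mem _
    have hK : (fun f : Weyl n → ℝ => if x.1 0 = 1 then (p - q) * ρ * f x else 0)
        ∈ Submodule.span ℝ (Set.range fun (y : Weyl n) (f : Weyl n → ℝ) => f y) := by
      split_ifs
      · exact Submodule.smul_mem _ ((p - q) * ρ) (hev _)
      · exact Submodule.zero_mem _
    convert Submodule.sub_mem _ (Submodule.add_mem _
      (Submodule.sum_mem _ fun i (_ : i ∈ Finset.univ) => hL i)
      (Submodule.sum_mem _ fun i (_ : i ∈ Finset.univ) => hR i)) hK using 1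
    funext f
    simp only [dualGenerator, Pi.sub_apply, Pi.add_apply, Finset.sum_apply]
  obtain ⟨c, hc⟩ := Finsupp.mem_span_range_iff_exists_finsupp.1 key
  refine ⟨c, fun f => ?_⟩
  rw [← congrFun hc f, Finsupp.sum, Finset.sum_apply]
  rfl

theorem dualGenerator_add (f g : Weyl n → ℝ) (x : Weyl n) :
    dualGenerator p q ρ (f + g) x = dualGenerator p q ρ f x + dualGenerator p q ρ g x := by
  obtain ⟨c, hc⟩ := exists_dualGenerator_eq_sum p q ρ x
  simp only [hc, Pi.add_apply, mul_add, Finset.sum_add_distrib]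

theorem dualGenerator_sub (f g : Weyl n → ℝ) (x : Weyl n) :
    dualGenerator p q ρ (f - g) x = dualGenerator p q ρ f x - dualGenerator p q ρ g x := by
  obtain ⟨c, hc⟩ := exists_dualGenerator_eq_sum p q ρ x
  simp only [hc, Pi.sub_apply, mul_sub, Finset.sum_sub_distrib]

theorem dualGenerator_smul (a : ℝ) (f : Weyl n → ℝ) (x : Weyl n) :
    dualGenerator p q ρ (a • f) x = a * dualGenerator p q ρ f x := by
  obtain ⟨c, hc⟩ := exists_dualGenerator_eq_sum p q ρ x
  simp only [hc, Pi.smul_apply, smul_eq_mul, Finset.mul_sum]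
  exact Finset.sum_congr rfl fun _ _ => by ring

theorem tendsto_dualGenerator {ι : Type*} {l : Filter ι} {F : ι → Weyl n → ℝ} {f : Weyl n → ℝ}
    (h : ∀ y, Tendsto (fun i => F i y) l (𝓝 (f y))) (x : Weyl n) :
    Tendsto (fun i => dualGenerator p q ρ (F i) x) l (𝓝 (dualGenerator p q ρ f x)) := by
  obtain ⟨c, hc⟩ := exists_dualGenerator_eq_sum p q ρ x
  simp only [hc]
  exact tendsto_finsetSum _ fun y _ => (h y).const_mul _

theorem continuous_dualGenerator {S : Type*} [TopologicalSpace S] {F : S → Weyl n → ℝ}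
    (h : ∀ y, Continuous fun s => F s y) (x : Weyl n) :
    Continuous fun s => dualGenerator p q ρ (F s) x :=
  continuous_iff_continuousAt.2 fun _ =>
    tendsto_dualGenerator p q ρ (fun y => (h y).continuousAt) x

theorem measurable_dualGenerator {S : Type*} [MeasurableSpace S] {F : S → Weyl n → ℝ}
    (h : ∀ y, Measurable fun s => F s y) (x : Weyl n) :
    Measurable fun s => dualGenerator p q ρ (F s) x := by
  obtain ⟨c, hc⟩ := exists_dualGenerator_eq_sum p q ρ x
  simp only [hc]
  exact Finset.measurable_sum _ fun y _ => (h y).const_mul _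

theorem integral_dualGenerator {S : Type*} [MeasurableSpace S] {μ : Measure S}
    {F : S → Weyl n → ℝ} (h : ∀ y, Integrable (fun s => F s y) μ) (x : Weyl n) :
    ∫ s, dualGenerator p q ρ (F s) x ∂μ
      = dualGenerator p q ρ (fun y => ∫ s, F s y ∂μ) x := by
  obtain ⟨c, hc⟩ := exists_dualGenerator_eq_sum p q ρ x
  simp only [hc]
  rw [integral_finsetSum _ fun y _ => (h y).const_mul _]
  simp only [integral_const_mul]

theorem abs_dualGenerator_le {c : ℝ} (hc : 0 ≤ c) {f : Weyl n → ℝ} {M : ℝ} (hM : 0 ≤ M)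
    (hf : ∀ x, |f x| ≤ M * expWeight c x) (x : Weyl n) :
    |dualGenerator p q ρ f x| ≤ dualBound n p q ρ c * M * expWeight c x := by
  classical
  have hW := expWeight_pos c x
  have hE := Real.exp_pos c
  have hjump : ∀ y, expWeight c y ≤ Real.exp c * expWeight c x →
      |f y - f x| ≤ (Real.exp c + 1) * M * expWeight c x := by
    intro y hy
    calc |f y - f x| ≤ |f y| + |f x| := abs_sub _ _
      _ ≤ M * (Real.exp c * expWeight c x) + M * expWeight c x :=
        add_le_add ((hf y).trans (mul_le_mul_of_nonneg_left hy hM)) (hf x)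
      _ = _ := by ring
  have hnn : 0 ≤ (Real.exp c + 1) * M * expWeight c x := by positivity
  have hL : |∑ i, if h : CanLeft x i then p * (f (moveLeft x i h) - f x) else 0|
      ≤ ∑ _i : Fin n, |p| * ((Real.exp c + 1) * M * expWeight c x) := by
    refine (Finset.abs_sum_le_sum_abs _ _).trans (Finset.sum_le_sum fun i _ => ?_)
    split_ifs with h
    · rw [abs_mul]
      exact mul_le_mul_of_nonneg_left (hjump _ (expWeight_moveLeft_le hc x i h)) (abs_nonneg _)
    · rw [abs_zero]; positivity
  have hR : |∑ i, if h : CanRight x i then q * (f (moveRight x i h) - f x) else 0|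
      ≤ ∑ _i : Fin n, |q| * ((Real.exp c + 1) * M * expWeight c x) := by
    refine (Finset.abs_sum_le_sum_abs _ _).trans (Finset.sum_le_sum fun i _ => ?_)
    split_ifs with h
    · rw [abs_mul]
      exact mul_le_mul_of_nonneg_left (hjump _ (expWeight_moveRight_le hc x i h)) (abs_nonneg _)
    · rw [abs_zero]; positivity
  have hK : |if x.1 0 = 1 then (p - q) * ρ * f x else 0|
      ≤ |(p - q) * ρ| * (M * expWeight c x) := by
    split_ifs
    · rw [abs_mul]
      exact mul_le_mul_of_nonneg_left (hf x) (abs_nonneg _)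
    · rw [abs_zero]; positivity
  unfold dualGenerator
  refine (abs_sub _ _).trans ((add_le_add ((abs_add_le _ _).trans (add_le_add hL hR)) hK).trans
    (le_of_eq ?_))
  simp only [Finset.sum_const, Finset.card_univ, Fintype.card_fin, nsmul_eq_mul, dualBound]
  ring

end DualGenerator

section Uniqueness

variable {n : ℕ} [NeZero n] {p q ρ : ℝ} {η : Config}

theorem abs_sub_le_of_isSolution {u v : ℝ≥0 → Weyl n → ℝ} (hu : IsSolution p q ρ η u)
    (hv : IsSolution p q ρ η v) {T : ℝ≥0} {c M : ℝ} (hc : 0 ≤ c) (hM : 0 ≤ M)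
    (hb : ∀ t ≤ T, ∀ x, |u t x - v t x| ≤ M * expWeight c x) (k : ℕ) :
    ∀ t ≤ T, ∀ x, |u t x - v t x|
      ≤ M * ((dualBound n p q ρ c * t) ^ k / k.factorial) * expWeight c x := by
  have hK := dualBound_nonneg (n := n) p q ρ c
  set K := dualBound n p q ρ c
  induction k with
  | zero => simpa using hb
  | succ k ih =>
    intro t ht x
    have hder : ∀ s : ℝ, 0 ≤ s → HasDerivWithinAt
        (fun s : ℝ => u s.toNNReal x - v s.toNNReal x)
        (dualGenerator p q ρ (u s.toNNReal - v s.toNNReal) x) (Set.Ici 0) s := by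
      intro s hs
      rw [dualGenerator_sub]
      have h1 := hu.evolution x s.toNNReal
      have h2 := hv.evolution x s.toNNReal
      rw [Real.coe_toNNReal s hs] at h1 h2
      exact h1.sub h2
    set A := M * expWeight c x with hA
    have hB : ∀ s : ℝ, HasDerivAt
        (fun s : ℝ => A * ((K * s) ^ (k + 1) / (k + 1).factorial))
        (K * (M * ((K * s) ^ k / k.factorial)) * expWeight c x) s := by
      intro s
      have h0 : HasDerivAt (fun s : ℝ => K * s) K s := by
        simpa using (hasDerivAt_id s).const_mul K
      refine (((h0.fun_pow (k + 1)).div_const ((k + 1).factorial : ℝ)).const_mul A).congr_deriv ?_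
      rw [Nat.factorial_succ]
      have : (k.factorial : ℝ) ≠ 0 := by positivity
      push_cast
      rw [hA]
      field_simp
    have := image_norm_le_of_norm_deriv_right_le_deriv_boundary
      (f := fun s : ℝ => u s.toNNReal x - v s.toNNReal x) (a := 0) (b := t)
      (fun s hs => ((hder s hs.1).continuousWithinAt).mono fun z hz => hz.1)
      (fun s hs => (hder s hs.1).mono fun z hz => hs.1.trans hz)
      (by simp [hu.initial, hv.initial]) hB
      (fun s hs => by
        rw [Real.norm_eq_abs]
        have hsT : s.toNNReal ≤ T := by
          refine le_trans ?_ ht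
          rw [Real.toNNReal_le_iff_le_coe]
          exact hs.2.le
        have hs0 : 0 ≤ s := hs.1
        refine abs_dualGenerator_le p q ρ hc (by positivity) (fun y => ?_) x
        have := ih _ hsT y
        rwa [Real.coe_toNNReal s hs.1] at this)
      (Set.right_mem_Icc.2 t.2)
    simp only [Real.toNNReal_coe, Real.norm_eq_abs] at this
    rw [hA] at this
    linarith

theorem IsSolution.eq {u v : ℝ≥0 → Weyl n → ℝ} (hu : IsSolution p q ρ η u)
    (hv : IsSolution p q ρ η v) : u = v := by
  funext T x
  obtain ⟨c, C, hc, hC, h⟩ := hu.growth (T + 1) (by positivity)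
  obtain ⟨c', C', hc', hC', h'⟩ := hv.growth (T + 1) (by positivity)
  have hb : ∀ t ≤ T, ∀ x, |u t x - v t x| ≤ (C + C') * expWeight (max c c') x := by
    intro t ht y
    have ht' : t ≤ T + 1 := ht.trans (le_add_of_nonneg_right zero_le_one)
    calc |u t y - v t y| ≤ |u t y| + |v t y| := abs_sub _ _
      _ ≤ C * expWeight c y + C' * expWeight c' y := add_le_add (h t ht' y) (h' t ht' y)
      _ ≤ C * expWeight (max c c') y + C' * expWeight (max c c') y :=
        add_le_add (mul_le_mul_of_nonneg_left (expWeight_mono (le_max_left _ _) y) hC.le)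
          (mul_le_mul_of_nonneg_left (expWeight_mono (le_max_right _ _) y) hC'.le)
      _ = _ := by ring
  have hk := fun k => abs_sub_le_of_isSolution hu hv (hc.le.trans (le_max_left c c'))
    (by positivity) hb k T le_rfl x
  have hlim := ((FloorSemiring.tendsto_pow_div_factorial_atTop
    (dualBound n p q ρ (max c c') * T)).const_mul (C + C')).mul_const (expWeight (max c c') x)
  rw [mul_zero, zero_mul] at hlim
  exact sub_eq_zero.1 (abs_nonpos_iff.1 (ge_of_tendsto' hlim hk))

end Uniqueness

section Existence

theorem exists_linear_evolution {E : Type*} [NormedAddCommGroup E] [NormedSpace ℝ E]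
    [CompleteSpace E] (D : E →L[ℝ] E) (F : E) :
    ∃ y : ℝ → E, y 0 = F ∧ ∀ t, HasDerivAt y (D (y t)) t := by
  refine ⟨fun t => NormedSpace.exp (t • D) F, by simp, fun t => ?_⟩
  exact (ContinuousLinearMap.apply ℝ E F).hasFDerivAt.comp_hasDerivAt t
    (hasDerivAt_exp_smul_const' D t)

variable {n : ℕ} [NeZero n] (p q ρ : ℝ)

theorem exists_bounded_evolution (f₀ : Weyl n → ℝ) {M : ℝ} (hf₀ : ∀ x, |f₀ x| ≤ M) :
    ∃ u : ℝ → Weyl n → ℝ, u 0 = f₀ ∧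
      (∀ x t, HasDerivAt (fun s => u s x) (dualGenerator p q ρ (u t) x) t) ∧
      ∀ T : ℝ, ∃ C, ∀ t ∈ Set.Icc 0 T, ∀ x, |u t x| ≤ C := by
  let _ : TopologicalSpace (Weyl n) := ⊥
  have : DiscreteTopology (Weyl n) := ⟨rfl⟩
  have hbound : ∀ (f : BoundedContinuousFunction (Weyl n) ℝ) (x : Weyl n),
      ‖dualGenerator p q ρ f x‖ ≤ dualBound n p q ρ 0 * ‖f‖ := by
    intro f x
    have := abs_dualGenerator_le p q ρ le_rfl (norm_nonneg f) (f := f)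
      (fun y => by rw [expWeight_zero, mul_one]; exact f.norm_coe_le_norm y) x
    rwa [expWeight_zero, mul_one] at this
  let D₀ : BoundedContinuousFunction (Weyl n) ℝ →ₗ[ℝ] BoundedContinuousFunction (Weyl n) ℝ :=
    { toFun := fun f => BoundedContinuousFunction.ofNormedAddCommGroupDiscrete
        (dualGenerator p q ρ f) _ (hbound f)
      map_add' := fun f g => by
        ext x
        exact dualGenerator_add p q ρ f g x
      map_smul' := fun a f => by
        ext x
        exact dualGenerator_smul p q ρ a f x }
  let D := D₀.mkContinuous (dualBound n p q ρ 0) fun f =>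
    (BoundedContinuousFunction.norm_le
      (mul_nonneg (dualBound_nonneg p q ρ 0) (norm_nonneg f))).2 (hbound f)
  let F := BoundedContinuousFunction.ofNormedAddCommGroupDiscrete f₀ M hf₀
  obtain ⟨y, hy0, hder⟩ := exists_linear_evolution D F
  refine ⟨fun t x => y t x, ?_, fun x t => ?_, fun T => ?_⟩
  · funext x
    simp only [hy0]
    rfl
  · exact (BoundedContinuousFunction.evalCLM ℝ x).hasFDerivAt.comp_hasDerivAt t (hder t)
  · have hcont : Continuous y := continuous_iff_continuousAt.2 fun t => (hder t).continuousAt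
    obtain ⟨C, hC⟩ := isCompact_Icc.exists_bound_of_continuousOn
      (hcont.continuousOn (s := Set.Icc 0 T))
    exact ⟨C, fun t ht x => (BoundedContinuousFunction.norm_coe_le_norm _ x).trans (hC t ht)⟩

theorem exists_isSolution {p q : ℝ} (ρ : ℝ) (hq : 0 < q) (hqp : q < p) (η : Config) :
    ∃ u : ℝ≥0 → Weyl n → ℝ, IsSolution p q ρ η u := by
  have hp : 0 < p := hq.trans hqp
  obtain ⟨u, hu0, hder, hbdd⟩ := exists_bounded_evolution p q ρ (H (q / p) η)
    (fun x : Weyl n => abs_H_le_one (by positivity) ((div_le_one hp).2 hqp.le) η x)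
  refine ⟨fun t => u t, ⟨fun x t => ?_, fun T _ => ?_, fun x => ?_⟩⟩
  · refine (hder x t).hasDerivWithinAt.congr (fun s hs => ?_) ?_
    · rw [Real.coe_toNNReal s hs]
    · rw [Real.toNNReal_coe]
  · obtain ⟨C, hC⟩ := hbdd T
    exact ⟨1, |C| + 1, one_pos, by positivity, fun t ht x =>
      growth_of_bounded x (hC t ⟨t.2, ht⟩ x)⟩
  · simp [hu0]

end Existence



section Limits

variable {r : ℝ} {η : Config}

theorem truncQ_eq_pow (r : ℝ) (L : ℕ+) (η : Config) (x : ℤ) :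
    truncQ r L η x
      = r ^ ((Finset.Icc 1 L).filter (fun i : ℕ+ => x ≤ ((i : ℕ) : ℤ) ∧ η i = true)).card := by
  unfold truncQ siteWeight
  rw [Finset.prod_ite, Finset.prod_const, Finset.prod_const_one, mul_one, Finset.filter_filter]

theorem tendsto_truncQ (hr : 0 ≤ r) (hr1 : r < 1) (η : Config) (x : ℤ) :
    Tendsto (fun L => truncQ r L η x) atTop (𝓝 (Q r η x)) := by
  simp only [truncQ_eq_pow]
  unfold Q N
  set S : Set ℕ+ := {i : ℕ+ | x ≤ ((i : ℕ) : ℤ) ∧ η i = true} with hS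
  by_cases hfin : S.Finite
  · rw [if_neg (Set.encard_ne_top_iff.2 hfin)]
    obtain ⟨B, hB⟩ := hfin.bddAbove
    refine tendsto_const_nhds.congr' ?_
    filter_upwards [eventually_ge_atTop B] with L hL
    congr 1
    rw [← ENat.natCast_inj, ENat.natCast_toNat (Set.encard_ne_top_iff.2 hfin),
      ← Set.encard_coe_eq_coe_finsetCard]
    congr 1
    ext i
    simp only [Finset.coe_filter, Finset.mem_Icc, Set.mem_ofPred_eq, hS]
    exact ⟨fun h => ⟨⟨one_le, (hB h).trans hL⟩, h⟩, fun h => h.2⟩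
  · rw [if_pos (Set.encard_eq_top_iff.2 hfin)]
    refine (tendsto_pow_atTop_nhds_zero_of_lt_one hr hr1).comp (tendsto_atTop.2 fun k => ?_)
    obtain ⟨t, htS, rfl⟩ := Set.Infinite.exists_subset_card_eq hfin k
    obtain ⟨B, hB⟩ := t.bddAbove
    filter_upwards [eventually_ge_atTop B] with L hL
    refine Finset.card_le_card fun i hi => ?_
    simp only [Finset.mem_filter, Finset.mem_Icc]
    exact ⟨⟨one_le, (hB hi).trans hL⟩, htS hi⟩

theorem tendsto_truncH {n : ℕ} (hr : 0 ≤ r) (hr1 : r < 1) (η : Config) (x : Weyl n) :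
    Tendsto (fun L => truncH r L η x) atTop (𝓝 (H r η x)) :=
  tendsto_finsetProd _ fun _ _ => tendsto_truncQ hr hr1 η _

variable {p q : ℝ}

theorem bondRate_nonneg (hp : 0 ≤ p) (hq : 0 ≤ q) (η : Config) (y : ℕ+) :
    0 ≤ bondRate p q η y := by
  unfold bondRate occ
  cases η y <;> cases η (y + 1) <;> simp [hp, hq]

theorem bondRate_le (hp : 0 ≤ p) (hq : 0 ≤ q) (η : Config) (y : ℕ+) :
    bondRate p q η y ≤ p + q := by
  unfold bondRate occ
  cases η y <;> cases η (y + 1) <;> simp [hp, hq] <;> linarith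

theorem abs_edgeTerm_le {n : ℕ} (hq : 0 < q) (hqp : q < p) (L : ℕ+) (x : Weyl n)
    (η : Config) : |edgeTerm p q L x η| ≤ p + q := by
  have hp : 0 < p := hq.trans hqp
  have hr : 0 ≤ q / p := by positivity
  have hr1 : q / p ≤ 1 := (div_le_one hp).2 hqp.le
  have h1 : |truncH (q / p) L (exchange η L) x - truncH (q / p) L η x| ≤ 1 := by
    rw [abs_le]
    constructor <;>
    linarith [truncH_nonneg hr L η x, truncH_le_one hr hr1 L η x,
      truncH_nonneg hr L (exchange η L) x, truncH_le_one hr hr1 L (exchange η L) x]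
  rw [edgeTerm, abs_mul, abs_of_nonneg (bondRate_nonneg hp.le hq.le _ _), ← mul_one (p + q)]
  exact mul_le_mul (bondRate_le hp.le hq.le _ _) h1 (abs_nonneg _) (by positivity)

theorem truncH_exchange_last_le {n : ℕ} (hr : 0 ≤ r) (hr1 : r ≤ 1) (L : ℕ+) (η : Config)
    (x : Weyl n) (hL : ∀ i, x.1 i ≤ ((L : ℕ) : ℤ)) :
    r ^ n * truncH r L (exchange η L) x ≤ truncH r L η x := by
  have : r ^ n = ∏ _i : Fin n, r := by simp
  rw [this, truncH, truncH, ← Finset.prod_mul_distrib]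
  refine Finset.prod_le_prod (fun i _ => mul_nonneg hr (truncQ_nonneg hr _ _ _)) fun i _ => ?_
  calc r * truncQ r L (exchange η L) (x.1 i)
      ≤ siteWeight r (η L) * truncQ r L (exchange η L) (x.1 i) :=
        mul_le_mul_of_nonneg_right (le_siteWeight hr1 _) (truncQ_nonneg hr _ _ _)
    _ = siteWeight r (η (L + 1)) * truncQ r L η (x.1 i) := truncQ_exchange_last r L η _ (hL i)
    _ ≤ 1 * truncQ r L η (x.1 i) :=
        mul_le_mul_of_nonneg_right (siteWeight_le_one hr1 _) (truncQ_nonneg hr _ _ _)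
    _ = _ := one_mul _

theorem eventually_le_atTop {n : ℕ} (x : Weyl n) :
    ∀ᶠ L : ℕ+ in atTop, ∀ i, x.1 i ≤ ((L : ℕ) : ℤ) := by
  refine eventually_all.2 fun i => ?_
  filter_upwards [eventually_ge_atTop (⟨(x.1 i).toNat, by have := x.2.2 i; omega⟩ : ℕ+)]
    with L hL
  have : (x.1 i).toNat ≤ (L : ℕ) := hL
  omega

theorem tendsto_edgeTerm {n : ℕ} [NeZero n] (hq : 0 < q) (hqp : q < p) (x : Weyl n)
    (η : Config) : Tendsto (fun L => edgeTerm p q L x η) atTop (𝓝 0) := by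
  have hp : 0 < p := hq.trans hqp
  have hr : 0 < q / p := by positivity
  have hr1 : q / p < 1 := (div_lt_one hp).2 hqp
  by_cases hH : H (q / p) η x = 0
  · have h0 := tendsto_truncH hr.le hr1 η x
    rw [hH] at h0
    have hex : Tendsto (fun L => truncH (q / p) L (exchange η L) x) atTop (𝓝 0) := by
      have h1 := h0.const_mul ((q / p) ^ n)⁻¹
      rw [mul_zero] at h1
      refine tendsto_of_tendsto_of_tendsto_of_le_of_le' tendsto_const_nhds h1
        (Eventually.of_forall fun L => truncH_nonneg hr.le L _ x) ?_
      filter_upwards [eventually_le_atTop x] with L hL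
      have := truncH_exchange_last_le hr.le hr1.le L η x hL
      rwa [inv_mul_eq_div, le_div_iff₀' (by positivity)]
    have hdiff := (hex.sub h0).abs.const_mul (p + q)
    rw [sub_zero, abs_zero, mul_zero] at hdiff
    refine squeeze_zero_norm (fun L => ?_) hdiff
    rw [Real.norm_eq_abs, edgeTerm, abs_mul, abs_of_nonneg (bondRate_nonneg hp.le hq.le _ _)]
    exact mul_le_mul_of_nonneg_right (bondRate_le hp.le hq.le _ _) (abs_nonneg _)
  · have hQ : Q (q / p) η (x.1 0) ≠ 0 := fun h => hH (Finset.prod_eq_zero (Finset.mem_univ 0) h)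
    have hN : {i : ℕ+ | x.1 0 ≤ ((i : ℕ) : ℤ) ∧ η i = true}.Finite := by
      rw [← Set.encard_ne_top_iff]
      exact fun h => hQ (if_pos h)
    obtain ⟨B, hB⟩ := hN.bddAbove
    refine tendsto_const_nhds.congr' ?_
    filter_upwards [eventually_gt_atTop B, eventually_le_atTop x] with L hL hx
    have hempty : ∀ y : ℕ+, L ≤ y → η y = false := by
      intro y hy
      by_contra h
      have hy' : (L : ℕ) ≤ y := hy
      have := hx 0
      exact absurd (hB ⟨by omega, by simpa using h⟩) (not_le.2 (hL.trans_le hy))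
    rw [edgeTerm, bondRate, occ, occ, hempty L le_rfl,
      hempty (L + 1) (PNat.lt_add_right _ _).le]
    simp

end Limits

section Measurability

theorem measurable_occ (x : ℕ+) : Measurable fun η : Config => occ η x :=
  (measurable_of_countable fun b : Bool => (if b then 1 else 0 : ℝ)).comp (measurable_pi_apply x)

theorem measurable_exchange (y : ℕ+) : Measurable fun η : Config => exchange η y :=
  measurable_pi_lambda _ fun _ => measurable_pi_apply _

theorem measurable_truncQ (r : ℝ) (L : ℕ+) (x : ℤ) : Measurable fun η => truncQ r L η x :=
  Finset.measurable_prod _ fun i _ =>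
    (measurable_of_countable (siteWeight r)).comp (measurable_pi_apply i)

variable {n : ℕ}

theorem measurable_truncH (r : ℝ) (L : ℕ+) (x : Weyl n) : Measurable fun η => truncH r L η x :=
  Finset.measurable_prod _ fun _ _ => measurable_truncQ r L _

theorem measurable_H {r : ℝ} (hr : 0 ≤ r) (hr1 : r < 1) (x : Weyl n) :
    Measurable fun η => H r η x :=
  measurable_of_tendsto_metrizable' atTop (fun L => measurable_truncH r L x)
    (tendsto_pi_nhds.2 fun η => tendsto_truncH hr hr1 η x)

theorem measurable_edgeTerm (p q : ℝ) (L : ℕ+) (x : Weyl n) :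
    Measurable (edgeTerm p q L x) := by
  unfold edgeTerm bondRate
  have h1 := measurable_occ L
  have h2 := measurable_occ (L + 1)
  have h3 := measurable_truncH (q / p) L x
  have h4 := h3.comp (measurable_exchange L)
  exact (((h1.const_mul p).mul (h2.const_sub 1)).add
    ((h2.const_mul q).mul (h1.const_sub 1))).mul (h4.sub h3)

theorem isLocal_truncH (r : ℝ) (L : ℕ+) (x : Weyl n) : IsLocal fun η => truncH r L η x := by
  refine ⟨Finset.Icc 1 L, fun η η' h => Finset.prod_congr rfl fun i _ => ?_⟩
  exact truncQ_congr r L fun j hj _ => h j (by simp [hj])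

/-- A right-continuous measurable process is jointly measurable. -/
theorem measurable_uncurry_of_rightContinuous {Ω E : Type*} [MeasurableSpace Ω]
    [TopologicalSpace E] [TopologicalSpace.PseudoMetrizableSpace E] [MeasurableSpace E]
    [BorelSpace E] {X : ℝ≥0 → Ω → E} (hX : ∀ t, Measurable (X t))
    (hc : ∀ ω t, ContinuousWithinAt (fun s => X s ω) (Set.Ici t) t) :
    Measurable fun z : ℝ≥0 × Ω => X z.1 z.2 := by
  obtain ⟨e, he⟩ : ∃ e : ℕ → ℕ → ℝ≥0, ∀ k m, e k m = (m + 1) / (k + 1) := ⟨_, fun _ _ => rfl⟩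
  obtain ⟨d, hd⟩ : ∃ d : ℕ → ℝ≥0 → ℝ≥0, ∀ k s, d k s = e k ⌊(k + 1 : ℝ≥0) * s⌋₊ :=
    ⟨_, fun _ _ => rfl⟩
  have hmeas : ∀ k, Measurable fun z : ℝ≥0 × Ω => X (d k z.1) z.2 := by
    intro k
    simp only [hd]
    have h1 : Measurable fun w : ℕ × Ω => X (e k w.1) w.2 :=
      measurable_from_prod_countable_right fun m => hX (e k m)
    have h2 : Measurable fun z : ℝ≥0 × Ω => (⌊(k + 1 : ℝ≥0) * z.1⌋₊, z.2) :=
      (Nat.measurable_floor.comp (measurable_fst.const_mul _)).prodMk measurable_snd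
    exact h1.comp h2
  have hge : ∀ k s, s ≤ d k s := by
    intro k s
    have := (Nat.lt_floor_add_one ((k + 1 : ℝ≥0) * s)).le
    rw [hd, he, le_div_iff₀ (by positivity), mul_comm]
    exact this
  have hle : ∀ k s, d k s ≤ s + 1 / (k + 1) := by
    intro k s
    have := Nat.floor_le (zero_le (a := (k + 1 : ℝ≥0) * s))
    have hk : (0 : ℝ≥0) < k + 1 := by positivity
    calc d k s ≤ ((k + 1) * s + 1) / (k + 1) := by
          rw [hd, he]; gcongr
      _ = s + 1 / (k + 1) := by field_simp
  refine measurable_of_tendsto_metrizable hmeas (tendsto_pi_nhds.2 fun z => ?_)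
  have hlim : Tendsto (fun k => d k z.1) atTop (𝓝 z.1) := by
    refine tendsto_of_tendsto_of_tendsto_of_le_of_le tendsto_const_nhds ?_
      (fun k => hge k z.1) (fun k => hle k z.1)
    simpa using tendsto_const_nhds.add (tendsto_one_div_add_atTop_nhds_zero_nat (𝕜 := ℝ≥0))
  exact (hc z.2 z.1).tendsto.comp
    (tendsto_nhdsWithin_iff.2 ⟨hlim, Eventually.of_forall fun k => hge k z.1⟩)

end Measurability

section Dynkin

variable {n : ℕ} [NeZero n] {p q α γ : ℝ} {η₀ : Config} {Ω : Type*} [mΩ : MeasurableSpace Ω]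
  {μ : Measure Ω} {ℱ : Filtration ℝ≥0 mΩ} {X : ℝ≥0 → Ω → Config}

theorem integrable_of_abs_le {S : Type*} [MeasurableSpace S] {ν : Measure S} [IsFiniteMeasure ν]
    {f : S → ℝ} (hf : Measurable f) {C : ℝ} (hC : ∀ s, |f s| ≤ C) : Integrable f ν :=
  Integrable.of_bound hf.aestronglyMeasurable C (Eventually.of_forall hC)

theorem IsHalfLineASEP.measurable (h : IsHalfLineASEP p q α γ η₀ μ ℱ X) (t : ℝ≥0) :
    Measurable (X t) :=
  (h.adapted t).mono (ℱ.le t) le_rfl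

theorem IsHalfLineASEP.measurable_uncurry (h : IsHalfLineASEP p q α γ η₀ μ ℱ X) :
    Measurable fun z : ℝ × Ω => X z.1.toNNReal z.2 :=
  (measurable_uncurry_of_rightContinuous h.measurable h.right_continuous).comp
    ((measurable_real_toNNReal.comp measurable_fst).prodMk measurable_snd)

variable [IsProbabilityMeasure μ]

/-- Dynkin's formula for bounded local functions with bounded measurable image under the
generator. -/
theorem IsHalfLineASEP.dynkin (h : IsHalfLineASEP p q α γ η₀ μ ℱ X) {f : Config → ℝ}
    (hf : IsLocal f) (hfm : Measurable f) {C : ℝ} (hfb : ∀ η, |f η| ≤ C)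
    (hgm : Measurable (generator p q α γ f)) {C' : ℝ}
    (hgb : ∀ η, |generator p q α γ f η| ≤ C') (t : ℝ≥0) :
    ∫ ω, f (X t ω) ∂μ = f η₀
      + ∫ z, generator p q α γ f (X z.1.toNNReal z.2)
          ∂((volume.restrict (Set.Ioc 0 (t : ℝ))).prod μ) := by
  have hm := h.martingale f hf
  have hint : Integrable (fun z : ℝ × Ω => generator p q α γ f (X z.1.toNNReal z.2))
      ((volume.restrict (Set.Ioc 0 (t : ℝ))).prod μ) :=
    integrable_of_abs_le (hgm.comp h.measurable_uncurry) fun _ => hgb _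
  have h1 := hm.setIntegral_eq (zero_le (a := t)) (MeasurableSet.univ)
  simp only [Measure.restrict_univ, NNReal.coe_zero, intervalIntegral.integral_same,
    sub_zero] at h1
  have h0 : ∫ ω, f (X 0 ω) ∂μ = f η₀ := by
    rw [integral_congr_ae (g := fun _ => f η₀)]
    · simp
    · filter_upwards [h.initial] with ω hω
      rw [hω]
  have hft : Integrable (fun ω => f (X t ω)) μ :=
    integrable_of_abs_le (hfm.comp (h.measurable t)) fun _ => hfb _
  simp only [intervalIntegral.integral_of_le t.coe_nonneg] at h1
  have hsw : Integrable (fun ω => ∫ s in Set.Ioc 0 (t : ℝ),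
      generator p q α γ f (X s.toNNReal ω)) μ := hint.integral_prod_right
  rw [integral_sub hft hsw, h0] at h1
  rw [integral_prod_symm _ hint]
  linarith

theorem IsHalfLineASEP.integral_truncH (h : IsHalfLineASEP p q α γ η₀ μ ℱ X) (hq : 0 < q)
    (hqp : q < p) (hLiggett : α / p + γ / q = 1) (t : ℝ≥0) (x : Weyl n) (L : ℕ+)
    (hL : ∀ i, x.1 i ≤ ((L : ℕ) : ℤ)) :
    ∫ ω, truncH (q / p) L (X t ω) x ∂μ = truncH (q / p) L η₀ x
      + ∫ z, (dualGenerator p q (α / p) (truncH (q / p) L (X z.1.toNNReal z.2)) x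
            + edgeTerm p q L x (X z.1.toNNReal z.2))
          ∂((volume.restrict (Set.Ioc 0 (t : ℝ))).prod μ) := by
  have hp : 0 < p := hq.trans hqp
  have hr : 0 ≤ q / p := by positivity
  have hr1 : q / p ≤ 1 := (div_le_one hp).2 hqp.le
  have hgen : generator p q α γ (fun ζ => truncH (q / p) L ζ x) = fun η =>
      dualGenerator p q (α / p) (truncH (q / p) L η) x + edgeTerm p q L x η :=
    funext fun η => generator_truncH L η x hq hqp hLiggett hL
  have hb : ∀ η (y : Weyl n), |truncH (q / p) L η y| ≤ 1 := fun η y => by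
    rw [abs_of_nonneg (truncH_nonneg hr _ _ _)]
    exact truncH_le_one hr hr1 _ _ _
  have := h.dynkin (isLocal_truncH (q / p) L x) (measurable_truncH _ L x) (fun η => hb η x)
    (C' := dualBound n p q (α / p) 0 + (p + q))
    (by
      rw [hgen]
      exact (measurable_dualGenerator p q _ (fun y => measurable_truncH _ L y) x).add
        (measurable_edgeTerm p q L x))
    (fun η => by
      rw [hgen]
      refine (abs_add_le _ _).trans (add_le_add ?_ (abs_edgeTerm_le hq hqp L x η))
      simpa [expWeight_zero] using abs_dualGenerator_le p q (α / p) le_rfl zero_le_one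
        (fun y => by simpa [expWeight_zero] using hb η y) x) t
  rw [this, hgen]

/-- The expectation of the duality function satisfies the integrated evolution equation. -/
theorem IsHalfLineASEP.integral_H (h : IsHalfLineASEP p q α γ η₀ μ ℱ X) (hq : 0 < q)
    (hqp : q < p) (hLiggett : α / p + γ / q = 1) (t : ℝ≥0) (x : Weyl n) :
    ∫ ω, H (q / p) (X t ω) x ∂μ = H (q / p) η₀ x
      + ∫ s in (0 : ℝ)..t, dualGenerator p q (α / p)
          (fun y => ∫ ω, H (q / p) (X s.toNNReal ω) y ∂μ) x := by
  have hp : 0 < p := hq.trans hqp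
  have hr : 0 ≤ q / p := by positivity
  have hr1 : q / p < 1 := (div_lt_one hp).2 hqp
  have hb : ∀ L η (y : Weyl n), |truncH (q / p) L η y| ≤ 1 := fun L η y => by
    rw [abs_of_nonneg (truncH_nonneg hr _ _ _)]
    exact truncH_le_one hr hr1.le _ _ _
  have hlhs : Tendsto (fun L => ∫ ω, truncH (q / p) L (X t ω) x ∂μ) atTop
      (𝓝 (∫ ω, H (q / p) (X t ω) x ∂μ)) :=
    tendsto_integral_filter_of_dominated_convergence (fun _ => 1)
      (Eventually.of_forall fun L =>
        ((measurable_truncH _ L x).comp (h.measurable t)).aestronglyMeasurable)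
      (Eventually.of_forall fun L => Eventually.of_forall fun ω => hb L _ x)
      (integrable_const _)
      (Eventually.of_forall fun ω => tendsto_truncH hr hr1 _ x)
  have hrhs : Tendsto (fun L => ∫ z, (dualGenerator p q (α / p)
        (truncH (q / p) L (X z.1.toNNReal z.2)) x + edgeTerm p q L x (X z.1.toNNReal z.2))
          ∂((volume.restrict (Set.Ioc 0 (t : ℝ))).prod μ)) atTop
      (𝓝 (∫ z, dualGenerator p q (α / p) (H (q / p) (X z.1.toNNReal z.2)) x
          ∂((volume.restrict (Set.Ioc 0 (t : ℝ))).prod μ))) := by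
    refine tendsto_integral_filter_of_dominated_convergence
      (fun _ => dualBound n p q (α / p) 0 + (p + q)) (Eventually.of_forall fun L => ?_)
      (Eventually.of_forall fun L => Eventually.of_forall fun z => ?_) (integrable_const _)
      (Eventually.of_forall fun z => ?_)
    · exact (((measurable_dualGenerator p q _ (fun y => measurable_truncH _ L y) x).add
        (measurable_edgeTerm p q L x)).comp h.measurable_uncurry).aestronglyMeasurable
    · refine (abs_add_le _ _).trans (add_le_add ?_ (abs_edgeTerm_le hq hqp L x _))
      simpa [expWeight_zero] using abs_dualGenerator_le p q (α / p) le_rfl zero_le_one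
        (fun y => by simpa [expWeight_zero] using hb L (X z.1.toNNReal z.2) y) x
    · have := (tendsto_dualGenerator p q (α / p)
        (fun y => tendsto_truncH hr hr1 (X z.1.toNNReal z.2) y) x).add
        (tendsto_edgeTerm hq hqp x (X z.1.toNNReal z.2))
      rwa [add_zero] at this
  have heq := tendsto_nhds_unique_of_eventuallyEq hlhs
    ((tendsto_truncH hr hr1 η₀ x).add hrhs) (by
      filter_upwards [eventually_le_atTop x] with L hL
      exact h.integral_truncH hq hqp hLiggett t x L hL)
  rw [heq, intervalIntegral.integral_of_le t.coe_nonneg, integral_prod]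
  · congr 1
    refine integral_congr_ae (Eventually.of_forall fun s => ?_)
    have hint : ∀ y : Weyl n,
        Integrable (fun ω => H (q / p) (X s.toNNReal ω) y) μ := fun y =>
      integrable_of_abs_le ((measurable_H hr hr1 y).comp (h.measurable s.toNNReal))
        fun ω => abs_H_le_one hr hr1.le _ y
    exact integral_dualGenerator p q (α / p) hint x
  · refine integrable_of_abs_le (C := dualBound n p q (α / p) 0)
      ((measurable_dualGenerator p q _ (fun y => measurable_H hr hr1 y) x).comp
        h.measurable_uncurry) fun z => ?_
    simpa [expWeight_zero] using abs_dualGenerator_le p q (α / p) le_rfl zero_le_one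
      (fun y => by simpa [expWeight_zero] using
        abs_H_le_one hr hr1.le (X z.1.toNNReal z.2) y) x

theorem IsHalfLineASEP.isSolution (h : IsHalfLineASEP p q α γ η₀ μ ℱ X) (hq : 0 < q)
    (hqp : q < p) (hLiggett : α / p + γ / q = 1) :
    IsSolution p q (α / p) η₀
      (fun t (x : Weyl n) => ∫ ω, H (q / p) (X t ω) x ∂μ) := by
  have hp : 0 < p := hq.trans hqp
  have hr : 0 ≤ q / p := by positivity
  have hr1 : q / p < 1 := (div_lt_one hp).2 hqp
  set v : ℝ≥0 → Weyl n → ℝ := fun t x => ∫ ω, H (q / p) (X t ω) x ∂μ with hv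
  have hvb : ∀ t x, |v t x| ≤ 1 := by
    intro t x
    have := norm_integral_le_of_norm_le_const (μ := μ) (f := fun ω => H (q / p) (X t ω) x)
      (Eventually.of_forall fun ω => abs_H_le_one hr hr1.le (X t ω) x)
    simpa using this
  have hvm : ∀ x, Measurable fun s : ℝ => v s.toNNReal x := by
    intro x
    exact (((measurable_H hr hr1 x).comp h.measurable_uncurry).stronglyMeasurable.integral_prod_right'
      (ν := μ)).measurable
  have hDm : ∀ x, Measurable fun s : ℝ => dualGenerator p q (α / p) (v s.toNNReal) x :=
    fun x => measurable_dualGenerator p q _ hvm x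
  have hDb : ∀ x (s : ℝ), |dualGenerator p q (α / p) (v s.toNNReal) x|
      ≤ dualBound n p q (α / p) 0 := by
    intro x s
    simpa [expWeight_zero] using abs_dualGenerator_le p q (α / p) le_rfl zero_le_one
      (fun y => by simpa [expWeight_zero] using hvb s.toNNReal y) x
  have heq : ∀ x (s : ℝ), v s.toNNReal x = H (q / p) η₀ x
      + ∫ s in (0 : ℝ)..(s.toNNReal : ℝ), dualGenerator p q (α / p) (v s.toNNReal) x :=
    fun x s => h.integral_H hq hqp hLiggett s.toNNReal x
  have hvc : ∀ x, Continuous fun s : ℝ => v s.toNNReal x := by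
    intro x
    rw [funext (heq x)]
    refine continuous_const.add ((intervalIntegral.continuous_primitive (fun a b => ?_) 0).comp
      (NNReal.continuous_coe.comp continuous_real_toNNReal))
    have : IsFiniteMeasure (volume.restrict (Set.uIoc a b)) := by
      rw [Set.uIoc]; infer_instance
    rw [intervalIntegrable_iff]
    exact integrable_of_abs_le (hDm x) (hDb x)
  refine ⟨fun x t => ?_, fun T _ => ⟨1, |1| + 1, one_pos, by positivity, fun t _ x =>
    growth_of_bounded x (hvb t x)⟩, fun x => ?_⟩
  · have hDc : Continuous fun s : ℝ => dualGenerator p q (α / p) (v s.toNNReal) x :=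
      continuous_dualGenerator p q _ hvc x
    have hd := ((hDc.integral_hasStrictDerivAt 0 (t : ℝ)).hasDerivAt.const_add
      (H (q / p) η₀ x)).hasDerivWithinAt (s := Set.Ici 0)
    simp only [Real.toNNReal_coe] at hd
    refine hd.congr (fun s hs => ?_) ?_
    · rw [heq, Real.coe_toNNReal s hs]
    · rw [heq, Real.toNNReal_coe]
  · have := heq x 0
    simpa using this

end Dynkin

end

end HalfLineASEP

theorem proposition2p7 (n : ℕ) [NeZero n] (p q α γ : ℝ) (hq : 0 < q) (hqp : q < p)
    (hα : 0 ≤ α) (hγ : 0 ≤ γ) (hLiggett : α / p + γ / q = 1)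
    (η : HalfLineASEP.Config) (hη : {x | η x = true}.Finite) :
    (∃! u : ℝ≥0 → HalfLineASEP.Weyl n → ℝ, HalfLineASEP.IsSolution p q (α / p) η u) ∧
    ∀ u : ℝ≥0 → HalfLineASEP.Weyl n → ℝ, HalfLineASEP.IsSolution p q (α / p) η u →
      ∀ (Ω : Type*) [mΩ : MeasurableSpace Ω] (μ : Measure Ω) [IsProbabilityMeasure μ]
        (ℱ : Filtration ℝ≥0 mΩ) (X : ℝ≥0 → Ω → HalfLineASEP.Config),
        HalfLineASEP.IsHalfLineASEP p q α γ η μ ℱ X →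
        ∀ (t : ℝ≥0) (x : HalfLineASEP.Weyl n),
          Integrable (fun ω => HalfLineASEP.H (q / p) (X t ω) x) μ ∧
          u t x = ∫ ω, HalfLineASEP.H (q / p) (X t ω) x ∂μ := by
  have hp : 0 < p := hq.trans hqp
  have hr : 0 ≤ q / p := by positivity
  have hr1 : q / p < 1 := (div_lt_one hp).2 hqp
  refine ⟨?_, fun u hu Ω mΩ μ _ ℱ X hX t x => ⟨?_, ?_⟩⟩
  · obtain ⟨u, hu⟩ := HalfLineASEP.exists_isSolution (n := n) (α / p) hq hqp η
    exact ⟨u, hu, fun v hv => hv.eq hu⟩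
  · exact HalfLineASEP.integrable_of_abs_le
      ((HalfLineASEP.measurable_H hr hr1 x).comp (hX.measurable t))
      fun ω => HalfLineASEP.abs_H_le_one hr hr1.le _ x
  · rw [hu.eq (hX.isSolution hq hqp hLiggett)]
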